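/- Let $\kappa$ be a regular uncountable cardinal. For a Boolean algebra $B$ let $\mathrm{Ult}(B)$ be its space of ultrafilters with the Stone topology, generated by the sets $\{p : a\in p\}$, $a\in B$. Call $B$ *$\kappa$-Corson* if there is a set $G\subseteq B$ that generates $B$ as a Boolean algebra and satisfies $|G\cap p|<\kappa$ for every $p\in\mathrm{Ult}(B)$; call $B$ *$\kappa$-Valdivia* if there are a generating set $G\subseteq B$ and a topologically dense set $D\subseteq\mathrm{Ult}(B)$ with $|G\cap p|<\kappa$ for every $p\in D$. A topological space $K$ has *local tightness $<\kappa$* if for every $A\subseteq K$ and every $p\in\overline{A}$, $$\min\{|S| : S\subseteq A,\ p\in\overline{S}\}<\kappa .$$ For a linearly ordered set $C$, the *interval algebra* $B(C)$ is the subalgebra of the power set algebra $\mathcal P(C)$ generated by the sets $[a,\rightarrow)=\{x\in C : x\ge a\}$, $a\in C$. Let $B$ be a $\kappa$-Valdivia Boolean algebra. 1. $B$ is $\kappa$-Corson if and only if $\mathrm{Ult}(B)$ has local tightness $<\kappa$. 2. If $B$ is not $\kappa$-Corson, then $\mathrm{Ult}(B)$ contains a homeomorphic copy of the ordinal $\kappa+1$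 with its order topology, and the interval algebra $B(\kappa)$ is a homomorphic image of $B$. -/

import Mathlib

open Cardinal

universe u

/-- The ultrafilters of a Boolean algebra: the proper filters that contain each element or its
complement. -/
def Ult (B : Type u) [BooleanAlgebra B] : Type u :=
  {p : Order.PFilter B // ⊥ ∉ p ∧ ∀ a : B, a ∈ p ∨ aᶜ ∈ p}

/-- The Stone topology, generated by the sets `{p | a ∈ p}` with `a ∈ B`. -/
instance Ult.instTopologicalSpace (B : Type u) [BooleanAlgebra B] : TopologicalSpace (Ult B) :=
  TopologicalSpace.generateFrom (Set.range fun a : B => {p : Ult B | a ∈ p.1})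

/-- `G` generates `B` as a Boolean algebra. -/
def Generates {B : Type u} [BooleanAlgebra B] (G : Set B) : Prop :=
  BooleanSubalgebra.closure G = ⊤

/-- `B` is `κ`-Corson: some generating set meets every ultrafilter in fewer than `κ` elements. -/
def IsCorsonAlg (κ : Cardinal.{u}) (B : Type u) [BooleanAlgebra B] : Prop :=
  ∃ G : Set B, Generates G ∧ ∀ p : Ult B, #{a : B | a ∈ G ∧ a ∈ p.1} < κ

/-- `B` is `κ`-Valdivia: some generating set meets every ultrafilter of a topologically dense set
in fewer than `κ` elements. -/
def IsValdiviaAlg (κ : Cardinal.{u}) (B : Type u) [BooleanAlgebra B] : Prop :=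
  ∃ (G : Set B) (D : Set (Ult B)), Generates G ∧ Dense D ∧
    ∀ p ∈ D, #{a : B | a ∈ G ∧ a ∈ p.1} < κ

/-- The local tightness of `p` with respect to `A`: the least cardinality of a subset of `A` whose
closure contains `p` (meaningful for `p ∈ closure A`). -/
noncomputable def localTightness {X : Type u} [TopologicalSpace X] (p : X) (A : Set X) :
    Cardinal.{u} :=
  sInf {c | ∃ S : Set X, S ⊆ A ∧ p ∈ closure S ∧ #S = c}

/-- `X` has local tightness `< κ`. -/
def HasLocalTightnessLT (κ : Cardinal.{u}) (X : Type u) [TopologicalSpace X] : Prop :=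
  ∀ (A : Set X) (p : X), p ∈ closure A → localTightness p A < κ

/-- The interval algebra of a chain `C`: the algebra of subsets of `C` generated by the final
segments `[a, →)`. -/
def intervalAlgebra (C : Type u) [LinearOrder C] : BooleanSubalgebra (Set C) :=
  BooleanSubalgebra.closure (Set.range fun a : C => Set.Ici a)

/-! An ultrafilter `p` is determined by its trace `G ∩ p`, and the Stone topology is pointwise
convergence of traces. Closing off in countably many steps (`exists_reflecting`) gives small sets
`Γ` of generators on which all finite patterns are realized by few points with trace inside `Γ`. For
a Corson algebra this bounds the tightness. In the Valdivia case it makes `Γ` retractive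
(`exists_retractive`): cutting any trace down to `Γ` again gives the trace of an ultrafilter.

If `B` is not Corson, some `p` has at least `κ` generators. A `κ`-chain of retractive sets, each
with a new generator of `p`, cuts `p` down to ultrafilters with strictly increasing traces. Filled
in at limits, they form a copy of `κ + 1`; evaluation along them maps `B` onto `B(κ)`; and by
regularity their limit is not in the closure of fewer than `κ` of them. -/

namespace Ult

/-! ### Ultrafilters and their traces on a generating set -/

variable {B : Type u} [BooleanAlgebra B]

theorem compl_mem_iff (p : Ult B) (a : B) : aᶜ ∈ p.1 ↔ a ∉ p.1 := by
  refine ⟨fun h h' => p.2.1 ?_, fun h => (p.2.2 a).resolve_left h⟩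
  exact Order.PFilter.mem_of_le (inf_compl_self a).le (Order.PFilter.inf_mem h' h)

theorem inf_mem_iff (p : Ult B) (a b : B) : a ⊓ b ∈ p.1 ↔ a ∈ p.1 ∧ b ∈ p.1 :=
  Order.PFilter.inf_mem_iff

theorem sup_mem_iff (p : Ult B) (a b : B) : a ⊔ b ∈ p.1 ↔ a ∈ p.1 ∨ b ∈ p.1 := by
  rw [← not_iff_not, ← compl_mem_iff, compl_sup, inf_mem_iff, compl_mem_iff, compl_mem_iff, not_or]

theorem isOpen_setOf_mem (a : B) : IsOpen {p : Ult B | a ∈ p.1} :=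
  TopologicalSpace.isOpen_generateFrom_of_mem ⟨a, rfl⟩

theorem isOpen_setOf_mem_iff (a : B) (q : Prop) : IsOpen {p : Ult B | a ∈ p.1 ↔ q} := by
  by_cases hq : q
  · simpa [hq] using isOpen_setOf_mem a
  · simpa [hq, compl_mem_iff] using isOpen_setOf_mem aᶜ

theorem isTopologicalBasis :
    TopologicalSpace.IsTopologicalBasis (Set.range fun a : B => {p : Ult B | a ∈ p.1}) := by
  refine TopologicalSpace.IsTopologicalBasis.mk ?_ ?_ rfl
  · rintro _ ⟨a, rfl⟩ _ ⟨b, rfl⟩ x hx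
    exact ⟨_, ⟨a ⊓ b, rfl⟩, (inf_mem_iff x a b).2 hx, fun y hy => (inf_mem_iff y a b).1 hy⟩
  · refine Set.eq_univ_of_forall fun x => ⟨_, ⟨⊤, rfl⟩, ?_⟩
    exact Order.PFilter.top_mem

instance : T2Space (Ult B) where
  t2 p q hpq := by
    have : ∃ a, ¬ (a ∈ p.1 ↔ a ∈ q.1) := by
      by_contra! h
      exact hpq (Subtype.ext (SetLike.ext h))
    obtain ⟨a, ha⟩ := this
    refine ⟨_, _, isOpen_setOf_mem_iff a (a ∈ p.1), isOpen_setOf_mem_iff a (a ∈ q.1),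
      Iff.rfl, Iff.rfl, ?_⟩
    rw [Set.disjoint_left]
    intro r h₁ h₂
    exact ha (h₁.symm.trans h₂)

/-- Membership of a fixed element in an ultrafilter is decided by finitely many generators. -/
theorem exists_finset_determining {G : Set B} (hG : Generates G) (b : B) :
    ∃ F : Finset B, ↑F ⊆ G ∧
      ∀ p q : Ult B, (∀ a ∈ F, a ∈ p.1 ↔ a ∈ q.1) → (b ∈ p.1 ↔ b ∈ q.1) := by
  classical
  have hb : b ∈ BooleanSubalgebra.closure G := by rw [hG]; trivial
  induction hb using BooleanSubalgebra.closure_bot_sup_induction with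
  | mem x hx => exact ⟨{x}, by simpa using hx, fun p q h => h x (by simp)⟩
  | bot => exact ⟨∅, by simp, fun p q _ => iff_of_false p.2.1 q.2.1⟩
  | sup x hx y hy ihx ihy =>
    obtain ⟨F, hF, hF'⟩ := ihx
    obtain ⟨E, hE, hE'⟩ := ihy
    refine ⟨F ∪ E, by simp [hF, hE], fun p q h => ?_⟩
    rw [sup_mem_iff, sup_mem_iff, hF' p q fun a ha => h a (by simp [ha]),
      hE' p q fun a ha => h a (by simp [ha])]
  | compl x hx ih =>
    obtain ⟨F, hF, hF'⟩ := ih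
    exact ⟨F, hF, fun p q h => by rw [compl_mem_iff, compl_mem_iff, hF' p q h]⟩

theorem mem_closure_of_forall_finset {G : Set B} (hG : Generates G) {S : Set (Ult B)} {p : Ult B}
    (h : ∀ F : Finset B, ↑F ⊆ G → ∃ s ∈ S, ∀ a ∈ F, a ∈ s.1 ↔ a ∈ p.1) : p ∈ closure S := by
  rw [isTopologicalBasis.mem_closure_iff]
  rintro _ ⟨b, rfl⟩ hb
  obtain ⟨F, hF, hF'⟩ := exists_finset_determining hG b
  obtain ⟨s, hs, hsp⟩ := h F hF
  exact ⟨s, (hF' s p hsp).2 hb, hs⟩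

theorem exists_mem_agreeing {A : Set (Ult B)} {p : Ult B} (hp : p ∈ closure A) (F : Finset B) :
    ∃ s ∈ A, ∀ a ∈ F, a ∈ s.1 ↔ a ∈ p.1 := by
  have ho : IsOpen (⋂ a ∈ F, {q : Ult B | a ∈ q.1 ↔ a ∈ p.1}) :=
    isOpen_biInter_finset fun a _ => isOpen_setOf_mem_iff a _
  obtain ⟨s, hs, hsA⟩ := mem_closure_iff.1 hp _ ho (by simp)
  exact ⟨s, hsA, by simpa using hs⟩

/-- The limit of a family of ultrafilters of `B` along an ultrafilter on the index type. -/
def limit {ι : Type*} (U : Ultrafilter ι) (x : ι → Ult B) : Ult B :=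
  ⟨(Order.IsPFilter.of_def (F := {b : B | ∀ᶠ i in (U : Filter ι), b ∈ (x i).1})
      ⟨⊤, Filter.Eventually.of_forall fun _ => Order.PFilter.top_mem⟩
      (fun a ha b hb => ⟨a ⊓ b, (ha.and hb).mono fun i h => (inf_mem_iff (x i) a b).2 h,
        inf_le_left, inf_le_right⟩)
      (fun hab ha => ha.mono fun _ h => Order.PFilter.mem_of_le hab h)).toPFilter,
    fun h => by
      obtain ⟨i, hi⟩ := Filter.Eventually.exists h
      exact (x i).2.1 hi,
    fun a => Ultrafilter.eventually_or.1 (Filter.Eventually.of_forall fun i => (x i).2.2 a)⟩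

theorem mem_limit {ι : Type*} (U : Ultrafilter ι) (x : ι → Ult B) (b : B) :
    b ∈ (limit U x).1 ↔ ∀ᶠ i in (U : Filter ι), b ∈ (x i).1 :=
  Iff.rfl

/-- A prescribed trace on `G` is realized as soon as it is finitely realized. -/
theorem exists_of_forall_finset {G T : Set B}
    (h : ∀ F : Finset B, ↑F ⊆ G → ∃ q : Ult B, ∀ a ∈ F, a ∈ q.1 ↔ a ∈ T) :
    ∃ q : Ult B, ∀ a ∈ G, a ∈ q.1 ↔ a ∈ T := by
  classical
  have h' : ∀ F : Finset B, ∃ q : Ult B, ∀ a ∈ F, a ∈ G → (a ∈ q.1 ↔ a ∈ T) := by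
    intro F
    obtain ⟨q, hq⟩ := h (F.filter (· ∈ G)) fun a ha => by simp_all
    exact ⟨q, fun a ha haG => hq a (by simp [ha, haG])⟩
  choose x hx using h'
  let U : Ultrafilter (Finset B) := Ultrafilter.of Filter.atTop
  refine ⟨limit U x, fun a ha => ?_⟩
  have hU : ∀ᶠ F in (U : Filter (Finset B)), a ∈ (x F).1 ↔ a ∈ T := by
    -- `U` refines `atTop`, so almost every `F` contains the given `a`.
    refine Ultrafilter.of_le Filter.atTop ?_
    filter_upwards [Filter.eventually_ge_atTop {a}] with F hF
    exact hx F a (by simpa using hF) ha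
  rw [mem_limit, Filter.eventually_congr hU, Filter.eventually_const]

/-- A family of ultrafilters of `B` induces a homomorphism into the power set of its index type. -/
def familyHom {ι : Type*} (x : ι → Ult B) : BoundedLatticeHom B (Set ι) where
  toFun b := {i | b ∈ (x i).1}
  map_sup' a b := Set.ext fun i => sup_mem_iff (x i) a b
  map_inf' a b := Set.ext fun i => inf_mem_iff (x i) a b
  map_top' := Set.eq_univ_of_forall fun _ => Order.PFilter.top_mem
  map_bot' := Set.eq_empty_of_forall_notMem fun i => (x i).2.1

theorem mem_familyHom {ι : Type*} (x : ι → Ult B) (b : B) (i : ι) :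
    i ∈ familyHom x b ↔ b ∈ (x i).1 :=
  Iff.rfl

/-- A map into `Ult B` is continuous if the preimages of the generating clopen sets are clopen. -/
theorem continuous_of_isClopen {G : Set B} (hG : Generates G) {X : Type*} [TopologicalSpace X]
    {e : X → Ult B} (h : ∀ a ∈ G, IsClopen {x | a ∈ (e x).1}) : Continuous e := by
  refine continuous_generateFrom_iff.2 ?_
  rintro _ ⟨b, rfl⟩
  refine IsClopen.isOpen (s := {x | b ∈ (e x).1}) ?_
  have hb : b ∈ BooleanSubalgebra.closure G := by rw [hG]; trivial
  induction hb using BooleanSubalgebra.closure_bot_sup_induction with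
  | mem x hx => exact h x hx
  | bot => simpa [(e _).2.1] using isClopen_empty
  | sup x hx y hy ihx ihy =>
    simpa only [sup_mem_iff, Set.ofPred_or] using ihx.union ihy
  | compl x hx ih => simpa only [compl_mem_iff, Set.compl_ofPred] using ih.compl

end Ult

/-! ### Closing-off argument -/

section Reflection

variable {κ : Cardinal.{u}}

theorem mk_setOf_finset_subset_lt (hκ' : ℵ₀ < κ) {α : Type u} {Γ : Set α} (hΓ : #Γ < κ) :
    #{F : Finset α | ↑F ⊆ Γ} < κ := by
  classical
  have hinj : #{F : Finset α | ↑F ⊆ Γ} ≤ #(Finset Γ) := by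
    refine Cardinal.mk_le_of_injective (f := fun F => F.1.subtype (· ∈ Γ)) fun F E h => ?_
    refine Subtype.ext (Finset.ext fun a => ?_)
    have hF : a ∈ F.1 → a ∈ Γ := fun ha => F.2 ha
    have hE : a ∈ E.1 → a ∈ Γ := fun ha => E.2 ha
    have key : ∀ ha : a ∈ Γ, a ∈ F.1 ↔ a ∈ E.1 := fun ha => by
      simpa using (Finset.ext_iff.1 h) ⟨a, ha⟩
    exact ⟨fun h => (key (hF h)).1 h, fun h => (key (hE h)).2 h⟩
  refine hinj.trans_lt ?_
  rcases finite_or_infinite Γ with _ | _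
  · exact (Cardinal.lt_aleph0_of_finite _).trans hκ'
  · rwa [Cardinal.mk_finset_of_infinite]

theorem exists_finite_subset_agreeing {α X : Type*} (supp : X → Set α) (A : Set X)
    (F : Finset α) :
    ∃ c ⊆ A, c.Finite ∧ ∀ x ∈ A, ∃ s ∈ c, ∀ a ∈ F, a ∈ supp s ↔ a ∈ supp x := by
  classical
  let f : X → Finset α := fun x => F.filter (· ∈ supp x)
  obtain ⟨c, hc, hbij⟩ := Set.SurjOn.exists_bijOn_subset (Set.surjOn_image f A)
  refine ⟨c, hc, ?_, fun x hx => ?_⟩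
  · refine Set.Finite.of_finite_image ?_ hbij.injOn
    refine (F.powerset.finite_toSet).subset ?_
    rintro _ ⟨x, _, rfl⟩
    exact Finset.mem_coe.2 (Finset.mem_powerset.2 (Finset.filter_subset _ _))
  · obtain ⟨s, hs, hsx⟩ := hbij.surjOn ⟨x, hx, rfl⟩
    refine ⟨s, hs, fun a ha => ?_⟩
    have := Finset.ext_iff.1 hsx a
    simpa [f, ha] using this

/-- Given a family of points with small supports, every small set of coordinates is contained in a
small set `Γ` on which all finite patterns of the family are realized by few members, whose supports
lie in `Γ`. -/
theorem exists_reflecting (hκ : κ.IsRegular) (hκ' : ℵ₀ < κ) {α X : Type u} (supp : X → Set α)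
    {A : Set X} (hA : ∀ x ∈ A, #(supp x) < κ) {Γ₀ : Set α} (hΓ₀ : #Γ₀ < κ) :
    ∃ Γ : Set α, Γ₀ ⊆ Γ ∧ #Γ < κ ∧ ∃ S ⊆ A, #S < κ ∧ (∀ s ∈ S, supp s ⊆ Γ) ∧
      ∀ x ∈ A, ∀ F : Finset α, ↑F ⊆ Γ → ∃ s ∈ S, ∀ a ∈ F, a ∈ supp s ↔ a ∈ supp x := by
  choose c hcA hcfin hc using exists_finite_subset_agreeing supp A
  let pts : Set α → Set X := fun Γ => ⋃ F ∈ {F : Finset α | ↑F ⊆ Γ}, c F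
  have hpts : ∀ Γ : Set α, #Γ < κ → #(pts Γ) < κ := fun Γ hΓ =>
    (card_biUnion_lt_iff_forall_of_isRegular hκ (mk_setOf_finset_subset_lt hκ' hΓ)).2
      fun F _ => (hcfin F).lt_aleph0.trans hκ'
  have hptsA : ∀ Γ, pts Γ ⊆ A := fun Γ => Set.iUnion₂_subset fun F _ => hcA F
  let step : Set α → Set α := fun Γ => Γ ∪ ⋃ x ∈ pts Γ, supp x
  have hstep : ∀ Γ : Set α, #Γ < κ → #(step Γ) < κ := fun Γ hΓ =>
    (mk_union_le _ _).trans_lt <| add_lt_of_lt hκ.aleph0_le hΓ <|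
      (card_biUnion_lt_iff_forall_of_isRegular hκ (hpts Γ hΓ)).2
        fun x hx => hA x (hptsA Γ hx)
  let seq : ℕ → Set α := fun n => step^[n] Γ₀
  have hseq : ∀ n, seq (n + 1) = step (seq n) := fun n => Function.iterate_succ_apply' _ _ _
  have hmono : Monotone seq := monotone_nat_of_le_succ fun n => by
    rw [hseq]; exact Set.subset_union_left
  have hseqlt : ∀ n, #(seq n) < κ := fun n => by
    induction n with
    | zero => exact hΓ₀
    | succ n ih => rw [hseq]; exact hstep _ ih
  have hΓ : #(⋃ n, seq n : Set α) < κ := by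
    have := (card_iUnion_lt_iff_forall_of_isRegular (ι := ULift.{u} ℕ)
      (t := fun n => seq n.down) hκ (by simpa using hκ')).2 fun n => hseqlt n.down
    refine lt_of_le_of_lt (mk_le_mk_of_subset ?_) this
    exact Set.iUnion_subset fun n => Set.subset_iUnion_of_subset ⟨n⟩ subset_rfl
  refine ⟨⋃ n, seq n, Set.subset_iUnion seq 0, hΓ, pts (⋃ n, seq n), hptsA _, hpts _ hΓ, ?_, ?_⟩
  · intro s hs
    obtain ⟨F, hF, hsF⟩ := Set.mem_iUnion₂.1 hs
    -- A finite `F` already lies in one stage `n`, so the supports of its witnesses enter at stage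
    -- `n + 1`.
    obtain ⟨n, hn⟩ := Directed.exists_mem_subset_of_finset_subset_biUnion
      (directed_of_isDirected_le hmono) hF
    refine Set.Subset.trans ?_ (Set.subset_iUnion seq (n + 1))
    rw [hseq]
    exact Set.subset_union_of_subset_right
      (Set.subset_biUnion_of_mem (u := supp) (Set.mem_iUnion₂.2 ⟨F, hn, hsF⟩)) _
  · intro x hx F hF
    obtain ⟨s, hs, h⟩ := hc F x hx
    exact ⟨s, Set.mem_iUnion₂.2 ⟨F, hF, hs⟩, h⟩

end Reflection

/-! ### Corson algebras have small local tightness -/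

section Tightness

variable {κ : Cardinal.{u}}

theorem localTightness_lt_iff {X : Type u} [TopologicalSpace X] {p : X} {A : Set X}
    (hp : p ∈ closure A) :
    localTightness p A < κ ↔ ∃ S ⊆ A, p ∈ closure S ∧ #S < κ := by
  constructor
  · intro h
    obtain ⟨S, hS, hpS, hc⟩ := csInf_mem
      (s := {c | ∃ S : Set X, S ⊆ A ∧ p ∈ closure S ∧ #S = c}) ⟨_, A, subset_rfl, hp, rfl⟩
    exact ⟨S, hS, hpS, hc.trans_lt h⟩
  · rintro ⟨S, hS, hpS, hc⟩
    exact lt_of_le_of_lt (csInf_le' ⟨S, hS, hpS, rfl⟩ : localTightness p A ≤ #S) hc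

/-- Reflect `A` over a `Γ` containing the trace of `p`. Outside `Γ` both `p` and the chosen points
omit every generator, so agreement on finite parts of `Γ` suffices. -/
theorem IsCorsonAlg.hasLocalTightnessLT (hκ : κ.IsRegular) (hκ' : ℵ₀ < κ) {B : Type u}
    [BooleanAlgebra B] (hB : IsCorsonAlg κ B) : HasLocalTightnessLT κ (Ult B) := by
  classical
  obtain ⟨G, hG, hsmall⟩ := hB
  intro A p hp
  rw [localTightness_lt_iff hp]
  obtain ⟨Γ, hpΓ, -, S, hSA, hS, hsupp, hreal⟩ := exists_reflecting hκ hκ'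
    (fun x : Ult B => {a : B | a ∈ G ∧ a ∈ x.1}) (A := A) (fun x _ => hsmall x) (hsmall p)
  refine ⟨S, hSA, Ult.mem_closure_of_forall_finset hG fun F hF => ?_, hS⟩
  obtain ⟨x, hxA, hx⟩ := Ult.exists_mem_agreeing hp (F.filter (· ∈ Γ))
  obtain ⟨s, hs, hsx⟩ := hreal x hxA (F.filter (· ∈ Γ)) fun a ha => by simp_all
  refine ⟨s, hs, fun a ha => ?_⟩
  by_cases haΓ : a ∈ Γ
  · have ha' : a ∈ F.filter (· ∈ Γ) := by simp [ha, haΓ]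
    have := hsx a ha'
    simp only [Set.mem_ofPred_eq, show a ∈ G from hF ha, true_and] at this
    exact this.trans (hx a ha')
  · exact iff_of_false (fun h => haΓ (hsupp s hs ⟨hF ha, h⟩)) fun h => haΓ (hpΓ ⟨hF ha, h⟩)

end Tightness

/-! ### Retractive sets and chains of them -/

section Retractions

variable {B : Type u} [BooleanAlgebra B] {κ : Cardinal.{u}}

/-- Erasing the generators outside `Γ` from the trace of an ultrafilter on `G` always leaves the
trace of an ultrafilter. -/
def Retractive (G Γ : Set B) : Prop :=
  ∀ x : Ult B, ∃ y : Ult B, ∀ a ∈ G, a ∈ y.1 ↔ a ∈ x.1 ∧ a ∈ Γ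

/-- By density, finite patterns of `x` on `Γ` occur in `D`, hence at points with trace inside `Γ`;
compactness then realizes the whole cut-down trace. -/
theorem exists_retractive (hκ : κ.IsRegular) (hκ' : ℵ₀ < κ) {G : Set B} {D : Set (Ult B)}
    (hD : Dense D) (hsmall : ∀ p ∈ D, #{a : B | a ∈ G ∧ a ∈ p.1} < κ) {Γ₀ : Set B}
    (hΓ₀ : #Γ₀ < κ) : ∃ Γ : Set B, Γ₀ ⊆ Γ ∧ #Γ < κ ∧ Retractive G Γ := by
  classical
  obtain ⟨Γ, hΓ₀Γ, hΓ, S, -, -, hsupp, hreal⟩ := exists_reflecting hκ hκ'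
    (fun x : Ult B => {a : B | a ∈ G ∧ a ∈ x.1}) hsmall hΓ₀
  refine ⟨Γ, hΓ₀Γ, hΓ, fun x => ?_⟩
  refine Ult.exists_of_forall_finset (T := {a | a ∈ x.1 ∧ a ∈ Γ}) fun F hF => ?_
  obtain ⟨d, hd, hdx⟩ := Ult.exists_mem_agreeing (hD x) (F.filter (· ∈ Γ))
  obtain ⟨s, hs, hsd⟩ := hreal d hd (F.filter (· ∈ Γ)) fun a ha => by simp_all
  refine ⟨s, fun a ha => ?_⟩
  by_cases haΓ : a ∈ Γ
  · have ha' : a ∈ F.filter (· ∈ Γ) := by simp [ha, haΓ]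
    have := hsd a ha'
    simp only [Set.mem_ofPred_eq, show a ∈ G from hF ha, true_and] at this
    simpa [haΓ] using this.trans (hdx a ha')
  · exact iff_of_false (fun h => haΓ (hsupp s hs ⟨hF ha, h⟩)) fun h => haΓ h.2

theorem Retractive.sUnion {G : Set B} {C : Set (Set B)} (hne : C.Nonempty)
    (hdir : DirectedOn (· ⊆ ·) C) (hC : ∀ Γ ∈ C, Retractive G Γ) : Retractive G (⋃₀ C) := by
  classical
  intro x
  refine Ult.exists_of_forall_finset (T := {a | a ∈ x.1 ∧ a ∈ ⋃₀ C}) fun F hF => ?_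
  obtain ⟨Γ, hΓ, hFΓ⟩ := hdir.exists_mem_subset_of_finite_of_subset_sUnion hne
    (F.filter (· ∈ ⋃₀ C)).finite_toSet fun a ha => (by simpa using ha : a ∈ F ∧ _).2
  obtain ⟨y, hy⟩ := hC Γ hΓ x
  refine ⟨y, fun a ha => (hy a (hF ha)).trans (and_congr_right fun _ => ?_)⟩
  exact ⟨fun h => ⟨Γ, hΓ, h⟩, fun h => hFΓ (by simpa [ha] using h)⟩

/-- An increasing chain of retractive sets along `ι` above a retractive set `base`, each of which
captures a new generator lying in `p`. -/
structure RetractiveChain (G : Set B) (p : Ult B) (ι : Type u) [LinearOrder ι] where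
  base : Set B
  level : ι → Set B
  retractive_base : Retractive G base
  retractive_level : ∀ i, Retractive G (level i)
  base_subset : ∀ i, base ⊆ level i
  monotone : Monotone level
  exists_new : ∀ i, ∃ g ∈ G, g ∈ p.1 ∧ g ∈ level i ∧ g ∉ base ∧ ∀ j < i, g ∉ level j

theorem nonempty_retractiveChain (hκ : κ.IsRegular) (hκ' : ℵ₀ < κ) {G : Set B}
    {D : Set (Ult B)} (hD : Dense D) (hsmall : ∀ p ∈ D, #{a : B | a ∈ G ∧ a ∈ p.1} < κ)
    {p : Ult B} (hp : κ ≤ #{a : B | a ∈ G ∧ a ∈ p.1}) :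
    Nonempty (RetractiveChain G p κ.ord.ToType) := by
  -- The size bound sits inside the existential so that `next` is total and can drive the recursion.
  have hnext : ∀ Γ : Set B, ∃ Γ' : Set B, #Γ < κ →
      Γ ⊆ Γ' ∧ #Γ' < κ ∧ Retractive G Γ' ∧ ∃ g ∈ G, g ∈ p.1 ∧ g ∈ Γ' ∧ g ∉ Γ := by
    intro Γ
    by_cases hΓ : #Γ < κ
    · have : ¬ {a : B | a ∈ G ∧ a ∈ p.1} ⊆ Γ := fun h =>
        (hp.trans (mk_le_mk_of_subset h)).not_gt hΓ
      obtain ⟨g, ⟨hgG, hgp⟩, hgΓ⟩ := Set.not_subset.1 this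
      have hins : #(insert g Γ : Set B) < κ :=
        mk_insert_le.trans_lt (add_lt_of_lt hκ.aleph0_le hΓ (one_lt_aleph0.trans hκ'))
      obtain ⟨Γ', h, hlt, hr⟩ := exists_retractive hκ hκ' hD hsmall hins
      exact ⟨Γ', fun _ => ⟨(Set.subset_insert _ _).trans h, hlt, hr, g, hgG, hgp,
        h (Set.mem_insert _ _), hgΓ⟩⟩
    · exact ⟨∅, fun h => absurd h hΓ⟩
  choose next hnext using hnext
  obtain ⟨base, -, hbase, hbaser⟩ := exists_retractive hκ hκ' hD hsmall (Γ₀ := ∅)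
    (by simpa using hκ.pos)
  obtain ⟨level, hlevel⟩ : ∃ level : κ.ord.ToType → Set B,
      ∀ i, level i = next (base ∪ ⋃ j ∈ Set.Iio i, level j) :=
    ⟨wellFounded_lt.fix fun i ih => next (base ∪ ⋃ j, ⋃ h : j < i, ih j h),
      fun i => wellFounded_lt.fix_eq _ i⟩
  have hlt : ∀ i, #(base ∪ ⋃ j ∈ Set.Iio i, level j : Set B) < κ := by
    intro i
    induction i using WellFoundedLT.induction with
    | ind i ih =>
      refine (mk_union_le _ _).trans_lt (add_lt_of_lt hκ.aleph0_le hbase ?_)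
      refine (card_biUnion_lt_iff_forall_of_isRegular hκ (by simpa using mk_Iio_lt i (by simp))).2
        fun j hj => ?_
      rw [hlevel]
      exact (hnext _ (ih j hj)).2.1
  have hsub : ∀ i, (base ∪ ⋃ j ∈ Set.Iio i, level j) ⊆ level i := fun i => by
    conv_rhs => rw [hlevel]
    exact (hnext _ (hlt i)).1
  refine ⟨⟨base, level, hbaser, fun i => ?_, fun i => Set.subset_union_left.trans (hsub i),
    fun i j hij => ?_, fun i => ?_⟩⟩
  · rw [hlevel]
    exact (hnext _ (hlt i)).2.2.1
  · rcases hij.eq_or_lt with rfl | h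
    · exact le_rfl
    · exact (Set.subset_biUnion_of_mem (u := level) (Set.mem_Iio.2 h)).trans
        (Set.subset_union_right.trans (hsub j))
  · obtain ⟨g, hgG, hgp, hg, hg'⟩ := (hnext _ (hlt i)).2.2.2
    rw [← hlevel] at hg
    refine ⟨g, hgG, hgp, hg, fun h => hg' (Or.inl h), fun j hj h => hg' (Or.inr ?_)⟩
    exact Set.mem_biUnion (Set.mem_Iio.2 hj) h

/-! ### Consequences of a retractive chain -/

namespace RetractiveChain

variable {G : Set B} {p : Ult B} {ι : Type u} [LinearOrder ι]

theorem exists_union (c : RetractiveChain G p ι) (I : Set ι) :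
    ∃ y : Ult B, ∀ a ∈ G, a ∈ y.1 ↔ a ∈ p.1 ∧ (a ∈ c.base ∨ ∃ i ∈ I, a ∈ c.level i) := by
  have hchain : IsChain (· ⊆ ·) (insert c.base (c.level '' I)) := by
    refine IsChain.insert ?_ ?_
    · rintro _ ⟨i, _, rfl⟩ _ ⟨j, _, rfl⟩ _
      exact (le_total i j).imp (fun h => c.monotone h) fun h => c.monotone h
    · rintro _ ⟨i, _, rfl⟩ _
      exact Or.inl (c.base_subset i)
  have hr : Retractive G (⋃₀ insert c.base (c.level '' I)) := by
    refine Retractive.sUnion (Set.insert_nonempty _ _) hchain.directedOn ?_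
    rintro _ (rfl | ⟨i, _, rfl⟩)
    exacts [c.retractive_base, c.retractive_level i]
  simpa using hr p

theorem exists_surjective_intervalAlgebra [WellFoundedLT ι] (c : RetractiveChain G p ι)
    (hG : Generates G) :
    ∃ f : BoundedLatticeHom B (intervalAlgebra ι), Function.Surjective f := by
  choose x hx using fun i => c.retractive_level i p
  have hgen : ∀ a ∈ G, Ult.familyHom x a ∈ intervalAlgebra ι := by
    intro a ha
    rcases (Ult.familyHom x a).eq_empty_or_nonempty with h | h
    · rw [h]; exact BooleanSubalgebra.bot_mem
    -- The indices whose level contains a given generator form a final segment of a well-order.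
    · have hmin : Ult.familyHom x a = Set.Ici (wellFounded_lt.min _ h) := by
        refine Set.Subset.antisymm (fun i hi => wellFounded_lt.min_le hi) fun i hi => ?_
        have := wellFounded_lt.min_mem _ h
        rw [Ult.mem_familyHom, hx _ a ha] at this ⊢
        exact ⟨this.1, c.monotone hi this.2⟩
      rw [hmin]
      exact BooleanSubalgebra.subset_closure ⟨_, rfl⟩
  have hmem : ∀ b, Ult.familyHom x b ∈ intervalAlgebra ι := by
    have : BooleanSubalgebra.closure G ≤ (intervalAlgebra ι).comap (Ult.familyHom x) :=
      BooleanSubalgebra.closure_le.2 hgen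
    rw [hG] at this
    exact fun b => this trivial
  have hsurj : intervalAlgebra ι ≤ (⊤ : BooleanSubalgebra B).map (Ult.familyHom x) := by
    refine BooleanSubalgebra.closure_le.2 ?_
    rintro _ ⟨i, rfl⟩
    obtain ⟨g, hgG, hgp, hgi, -, hg⟩ := c.exists_new i
    refine ⟨g, trivial, Set.ext fun j => ?_⟩
    rw [Ult.mem_familyHom, hx j g hgG]
    exact ⟨fun h => not_lt.1 fun hj => hg j hj h.2, fun h => ⟨hgp, c.monotone h hgi⟩⟩
  refine ⟨{ toFun := fun b => ⟨Ult.familyHom x b, hmem b⟩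
            map_sup' := fun a b => Subtype.ext (map_sup (Ult.familyHom x) a b)
            map_inf' := fun a b => Subtype.ext (map_inf (Ult.familyHom x) a b)
            map_top' := Subtype.ext (map_top (Ult.familyHom x))
            map_bot' := Subtype.ext (map_bot (Ult.familyHom x)) }, ?_⟩
  rintro ⟨s, hs⟩
  obtain ⟨b, -, hb⟩ := hsurj hs
  exact ⟨b, Subtype.ext hb⟩

theorem not_hasLocalTightnessLT [Nonempty ι] (c : RetractiveChain G p ι) (hG : Generates G)
    (hκ : κ ≤ Order.cof ι) :
    ¬ HasLocalTightnessLT κ (Ult B) := by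
  classical
  intro ht
  choose x hx using fun i => c.retractive_level i p
  obtain ⟨q, hq⟩ := c.exists_union Set.univ
  have hq' : ∀ a ∈ G, a ∈ q.1 ↔ a ∈ p.1 ∧ a ∈ ⋃ i, c.level i := by
    intro a ha
    rw [hq a ha]
    refine and_congr_right fun _ => ⟨?_, fun h => Or.inr (by simpa using h)⟩
    rintro (h | ⟨i, -, h⟩)
    · exact Set.mem_iUnion.2 ⟨Classical.arbitrary ι, c.base_subset _ h⟩
    · exact Set.mem_iUnion.2 ⟨i, h⟩
  have hcl : q ∈ closure (Set.range x) := by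
    refine Ult.mem_closure_of_forall_finset hG fun F hF => ?_
    obtain ⟨i, hi⟩ := Directed.exists_mem_subset_of_finset_subset_biUnion
      (directed_of_isDirected_le c.monotone) (s := F.filter (· ∈ ⋃ i, c.level i))
      fun a ha => (by simpa using ha : a ∈ F ∧ _).2
    refine ⟨x i, ⟨i, rfl⟩, fun a ha => ?_⟩
    rw [hx i a (hF ha), hq' a (hF ha)]
    refine and_congr_right fun _ => ⟨fun h => Set.mem_iUnion.2 ⟨i, h⟩, fun h => hi ?_⟩
    simpa [ha] using h
  obtain ⟨S, hS, hqS, hlt⟩ := (localTightness_lt_iff hcl).1 (ht _ _ hcl)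
  obtain ⟨I, -, hI⟩ := Set.SurjOn.exists_bijOn_subset (f := x) (s := Set.univ) (t := S)
    fun s hs => by simpa using hS hs
  have hIlt : #I < κ := by
    rwa [← mk_image_eq_of_injOn x I hI.injOn, hI.image_eq]
  -- With `I` bounded strictly by `j`, the generator new at `j` separates `q` from all of `S`.
  have hcof : ¬ IsCofinal I := fun h => (hκ.trans (Order.cof_le h)).not_gt hIlt
  simp only [IsCofinal, not_forall, not_exists, not_and, not_le] at hcof
  obtain ⟨j, hj⟩ := hcof
  obtain ⟨g, hgG, hgp, hgj, -, hg⟩ := c.exists_new j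
  obtain ⟨s, hs, hsS⟩ := mem_closure_iff.1 hqS _ (Ult.isOpen_setOf_mem g)
    ((hq' g hgG).2 ⟨hgp, Set.mem_iUnion.2 ⟨j, hgj⟩⟩)
  obtain ⟨i, hi, rfl⟩ := hI.surjOn hsS
  exact hg i (hj i hi) ((hx i g hgG).1 hs).2

theorem exists_isEmbedding {o : Ordinal.{u}} (c : RetractiveChain G p o.ToType)
    (hG : Generates G) : ∃ e : Set.Iic o → Ult B, Topology.IsEmbedding e := by
  let r : o.ToType → Ordinal.{u} := fun i => (Ordinal.ToType.mk.symm i : Set.Iio o)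
  have hr : ∀ i j, r i < r j ↔ i < j := fun i j => by simp [r]
  -- The strict `r i < α` makes `e` continuous at limits and adds the endpoint `α = o`; `α = 0`
  -- leaves only `c.base`.
  choose e he using fun α : Set.Iic o => c.exists_union {i | r i < α.1}
  refine ⟨e, Topology.IsClosedEmbedding.isEmbedding ?_⟩
  have : CompactSpace (Set.Iic o) := isCompact_iff_compactSpace.1 (by
    rw [← Set.Icc_bot]; exact isCompact_Icc)
  refine Continuous.isClosedEmbedding (Ult.continuous_of_isClopen hG fun a ha => ?_) ?_
  · simp only [he _ a ha]
    by_cases hap : a ∈ p.1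
    swap
    · simpa [hap] using isClopen_empty
    by_cases hab : a ∈ c.base
    · simpa [hap, hab] using isClopen_univ
    simp only [hap, hab, true_and, false_or, Set.mem_ofPred_eq]
    rcases Set.eq_empty_or_nonempty {i | a ∈ c.level i} with h | h
    · have : ∀ i, a ∉ c.level i := fun i hi => (h ▸ hi : i ∈ (∅ : Set _))
      simpa [this] using isClopen_empty
    · have hmin : {α : Set.Iic o | ∃ i, r i < α.1 ∧ a ∈ c.level i} =
          Subtype.val ⁻¹' Set.Ioi (r (wellFounded_lt.min _ h)) := by
        ext α
        refine ⟨?_, fun hα => ⟨_, hα, wellFounded_lt.min_mem _ h⟩⟩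
        rintro ⟨i, hi, hai⟩
        rw [Set.mem_preimage, Set.mem_Ioi]
        refine lt_of_le_of_lt (not_lt.1 fun hlt => ?_) hi
        exact wellFounded_lt.not_lt_min {i | a ∈ c.level i} hai ((hr _ _).1 hlt)
      -- An open ray above an ordinal is the closed ray from its successor, hence clopen.
      rw [hmin]
      refine ⟨?_, isOpen_Ioi.preimage continuous_subtype_val⟩
      rw [← Order.Ici_succ]
      exact isClosed_Ici.preimage continuous_subtype_val
  · have key : ∀ α β : Set.Iic o, α.1 < β.1 → e α ≠ e β := by
      intro α β hαβ heq
      let i : o.ToType := Ordinal.ToType.mk ⟨α.1, hαβ.trans_le β.2⟩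
      have hi : r i = α.1 := by simp [r, i]
      obtain ⟨g, hgG, hgp, hgi, hgb, hg⟩ := c.exists_new i
      have hβ : g ∈ (e β).1 := (he β g hgG).2 ⟨hgp, Or.inr ⟨i, hi.trans_lt hαβ, hgi⟩⟩
      rw [← heq, he α g hgG] at hβ
      obtain ⟨-, h | ⟨j, hj, hgj⟩⟩ := hβ
      · exact hgb h
      · exact hg j ((hr _ _).1 (lt_of_lt_of_eq hj hi.symm)) hgj
    intro α β h
    rcases lt_trichotomy α.1 β.1 with hlt | heq | hlt
    · exact absurd h (key α β hlt)
    · exact Subtype.ext heq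
    · exact absurd h.symm (key β α hlt)

end RetractiveChain

end Retractions

theorem mainTheorem6 (κ : Cardinal.{u}) (hκ : κ.IsRegular) (hκ' : ℵ₀ < κ)
    (B : Type u) [BooleanAlgebra B] (hB : IsValdiviaAlg κ B) :
    (IsCorsonAlg κ B ↔ HasLocalTightnessLT κ (Ult B)) ∧
    (¬ IsCorsonAlg κ B →
      (∃ e : Set.Iic κ.ord → Ult B, Topology.IsEmbedding e) ∧
      ∃ f : BoundedLatticeHom B (intervalAlgebra κ.ord.ToType), Function.Surjective f) := by
  obtain ⟨G, D, hG, hD, hsmall⟩ := hB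
  have hchain : ¬ IsCorsonAlg κ B → ∃ p : Ult B,
      Nonempty (RetractiveChain G p κ.ord.ToType) := by
    intro h
    have : ∃ p : Ult B, κ ≤ #{a : B | a ∈ G ∧ a ∈ p.1} := by
      by_contra! hlt
      exact h ⟨G, hG, hlt⟩
    obtain ⟨p, hp⟩ := this
    exact ⟨p, nonempty_retractiveChain hκ hκ' hD hsmall hp⟩
  refine ⟨⟨fun h => h.hasLocalTightnessLT hκ hκ', fun ht => ?_⟩, fun h => ?_⟩
  · by_contra h
    obtain ⟨p, ⟨c⟩⟩ := hchain h
    have : Nonempty κ.ord.ToType := by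
      rw [← mk_ne_zero_iff, mk_ord_toType]
      exact hκ.pos.ne'
    refine c.not_hasLocalTightnessLT hG ?_ ht
    rw [Ordinal.cof_toType, hκ.cof_ord]
  · obtain ⟨p, ⟨c⟩⟩ := hchain h
    exact ⟨c.exists_isEmbedding hG, c.exists_surjective_intervalAlgebra hG⟩
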